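/- Let $E$ be a complex vector space of dimension $2$, let $f,g$ be linear endomorphisms of $E$, and let $(t_n)_{n\ge 0}$ be a strictly increasing sequence of integers with $t_0=1$ and $t_1=2$. Suppose that $\exp(t_n f+g)=\exp(t_n f)\circ\exp(g)$ for every $n\in\mathbb{N}$, where $\exp(u)=\sum_{k\ge 0}u^k/k!$ is the exponential of an endomorphism $u$ of $E$. Then $f$ and $g$ are simultaneously trigonalizable: there is a basis of $E$ in which the matrices of $f$ and of $g$ are both upper triangular. -/

import Mathlib

noncomputable section

/-- The exponential `exp u = ∑ uⁿ / n!` of an endomorphism `u` of a finite-dimensional complex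
vector space `E`. The algebra `L(E)` carries its canonical topology (the module topology, which is
the only Hausdorff vector space topology on it), so that no norm on `E` has to be chosen. -/
def endExp {E : Type*} [AddCommGroup E] [Module ℂ E] [FiniteDimensional ℂ E]
    (u : Module.End ℂ E) : Module.End ℂ E :=
  letI : TopologicalSpace (Module.End ℂ E) := moduleTopology ℂ (Module.End ℂ E)
  haveI : IsModuleTopology ℂ (Module.End ℂ E) := ⟨rfl⟩
  haveI : IsTopologicalRing (Module.End ℂ E) :=
    IsModuleTopology.isTopologicalRing ℂ (Module.End ℂ E)
  NormedSpace.exp u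

/-- Two endomorphisms of a finite-dimensional vector space are simultaneously trigonalizable if
their matrices in one common basis are both upper triangular. -/
def SimultaneouslyTrigonalizable {K E : Type*} [Field K] [AddCommGroup E] [Module K E]
    (f g : Module.End K E) : Prop :=
  ∃ b : Module.Basis (Fin (Module.finrank K E)) K E,
    (LinearMap.toMatrix b b f).BlockTriangular id ∧
      (LinearMap.toMatrix b b g).BlockTriangular id

end

/-! Subtract scalars so that F and G are traceless: then F², G² and FG + GF are scalars a, b, c, and
exp(s + Y) = e^s (cosh γ + sinhc γ · Y) whenever Y² = γ². Without a common eigenvector, 1, F, G, FG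
are independent and c² ≠ 4ab, so coefficients in the hypothesis can be compared. At t = 1 this makes
`sinhc` vanish at the square roots α, β of a, b, hence at every root γₙ of tₙ²a + tₙc + b. All these
roots lie in πiℤ; dividing by -π², an integral quadratic takes square values at arbitrarily large
integers, so its discriminant vanishes and c² = 4ab, a contradiction. -/

/-! ### Exponential of a scalar plus a square root of a scalar -/

/-- The entire function `sinh z / z`. -/
noncomputable def Complex.sinhc (z : ℂ) : ℂ := if z = 0 then 1 else Complex.sinh z / z

theorem Complex.hasSum_exp (z : ℂ) :
    HasSum (fun n : ℕ => (n.factorial : ℂ)⁻¹ * z ^ n) (Complex.exp z) := by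
  have h := NormedSpace.expSeries_div_hasSum_exp z
  rw [← Complex.exp_eq_exp_ℂ] at h
  simpa only [div_eq_inv_mul] using h

theorem Complex.hasSum_exp_deriv (z : ℂ) :
    HasSum (fun n : ℕ => (n.factorial : ℂ)⁻¹ * (n * z ^ (n - 1))) (Complex.exp z) := by
  rw [← hasSum_nat_add_iff' 1]
  simp only [Finset.range_one, Finset.sum_singleton, Nat.cast_zero, zero_mul, mul_zero, sub_zero]
  refine (Complex.hasSum_exp z).congr_fun fun n => ?_
  rw [Nat.factorial_succ, Nat.add_sub_cancel]
  have h1 : ((n.factorial : ℕ) : ℂ) ≠ 0 := by exact_mod_cast n.factorial_ne_zero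
  have h2 : ((n + 1 : ℕ) : ℂ) ≠ 0 := by exact_mod_cast n.succ_ne_zero
  push_cast at h2 ⊢
  field_simp

theorem smul_one_add_pow_of_sq_eq_zero {A : Type*} [Ring A] [Algebra ℂ A] {s : ℂ} {Y : A}
    (hY : Y * Y = 0) (n : ℕ) :
    (s • (1 : A) + Y) ^ n = s ^ n • (1 : A) + (n * s ^ (n - 1)) • Y := by
  induction n with
  | zero => simp
  | succ n ih =>
    rw [pow_succ, ih]
    simp only [mul_add, add_mul, smul_mul_assoc, mul_smul_comm, hY, one_mul, mul_one, smul_zero,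
      add_zero, Nat.add_sub_cancel]
    rcases n with _ | n
    · simp
    · simp only [Nat.add_sub_cancel]
      push_cast
      module

/-- The elements (1 ± Y/γ)/2 are the spectral idempotents of Y for ±γ. -/
theorem smul_one_add_pow_of_sq_eq {A : Type*} [Ring A] [Algebra ℂ A] {s γ : ℂ} (hγ : γ ≠ 0)
    {Y : A} (hY : Y * Y = (γ * γ) • (1 : A)) (n : ℕ) :
    (s • (1 : A) + Y) ^ n = (s + γ) ^ n • ((1 / 2 : ℂ) • (1 : A) + (1 / (2 * γ)) • Y)
      + (s - γ) ^ n • ((1 / 2 : ℂ) • (1 : A) - (1 / (2 * γ)) • Y) := by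
  induction n with
  | zero => simp only [pow_zero]; module
  | succ n ih =>
    rw [pow_succ, ih]
    simp only [mul_add, add_mul, sub_mul, smul_mul_assoc, mul_smul_comm, hY, one_mul,
      mul_one, smul_add, smul_sub, smul_smul]
    match_scalars <;> field_simp <;> ring

theorem NormedSpace.exp_smul_one_add_of_sq_eq {A : Type*} [Ring A] [Algebra ℂ A]
    [TopologicalSpace A] [IsTopologicalRing A] [ContinuousSMul ℂ A] [T2Space A] {s γ : ℂ} {Y : A}
    (hY : Y * Y = (γ * γ) • (1 : A)) :
    NormedSpace.exp (s • (1 : A) + Y) =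
      Complex.exp s • (Complex.cosh γ • (1 : A) + Complex.sinhc γ • Y) := by
  rw [NormedSpace.exp_eq_tsum ℂ]
  refine HasSum.tsum_eq ?_
  -- For γ = 0 the spectral idempotents do not exist, but Y² = 0 truncates the binomial expansion.
  by_cases hγ : γ = 0
  · subst hγ
    have h := ((Complex.hasSum_exp s).smul_const (1 : A)).add
      ((Complex.hasSum_exp_deriv s).smul_const Y)
    rw [show Complex.exp s • (Complex.cosh 0 • (1 : A) + Complex.sinhc 0 • Y) =
      Complex.exp s • (1 : A) + Complex.exp s • Y by simp [Complex.sinhc]]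
    refine h.congr_fun fun n => ?_
    rw [smul_one_add_pow_of_sq_eq_zero (by simpa using hY)]
    module
  · have h := ((Complex.hasSum_exp (s + γ)).smul_const
        ((1 / 2 : ℂ) • (1 : A) + (1 / (2 * γ)) • Y)).add
      ((Complex.hasSum_exp (s - γ)).smul_const
        ((1 / 2 : ℂ) • (1 : A) - (1 / (2 * γ)) • Y))
    rw [show Complex.exp s • (Complex.cosh γ • (1 : A) + Complex.sinhc γ • Y) =
        Complex.exp (s + γ) • ((1 / 2 : ℂ) • (1 : A) + (1 / (2 * γ)) • Y) +
        Complex.exp (s - γ) • ((1 / 2 : ℂ) • (1 : A) - (1 / (2 * γ)) • Y) by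
      simp only [Complex.sinhc, hγ, if_false, Complex.cosh, Complex.sinh, sub_eq_add_neg s γ,
        Complex.exp_add]
      match_scalars <;> field_simp
      ring]
    refine h.congr_fun fun n => ?_
    rw [smul_one_add_pow_of_sq_eq hγ hY]
    module

theorem endExp_smul_one_add_of_sq_eq {E : Type*} [AddCommGroup E] [Module ℂ E]
    [FiniteDimensional ℂ E] {s γ : ℂ} {Y : Module.End ℂ E}
    (hY : Y * Y = (γ * γ) • (1 : Module.End ℂ E)) :
    endExp (s • (1 : Module.End ℂ E) + Y) =
      Complex.exp s • (Complex.cosh γ • (1 : Module.End ℂ E) + Complex.sinhc γ • Y) := by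
  let : TopologicalSpace (Module.End ℂ E) := moduleTopology ℂ (Module.End ℂ E)
  have : IsModuleTopology ℂ (Module.End ℂ E) := ⟨rfl⟩
  have : IsTopologicalRing (Module.End ℂ E) :=
    IsModuleTopology.isTopologicalRing ℂ (Module.End ℂ E)
  have : T2Space (Module.End ℂ E) :=
    T2Space.of_injective_continuous
      (Module.finBasis ℂ (Module.End ℂ E)).equivFun.injective
      (IsModuleTopology.continuous_of_linearMap
        (Module.finBasis ℂ (Module.End ℂ E)).equivFun.toLinearMap)
  exact NormedSpace.exp_smul_one_add_of_sq_eq hY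

/-- The value 1 at the origin is what excludes k = 0. -/
theorem Complex.exists_int_of_sinhc_eq_zero {z : ℂ} (hz : Complex.sinhc z = 0) :
    ∃ k : ℤ, k ≠ 0 ∧ z = k * Real.pi * Complex.I := by
  unfold Complex.sinhc at hz
  split_ifs at hz with h0
  · simp at hz
  · have h1 : Complex.sinh z = 0 := by simpa [h0] using hz
    have h2 : Complex.sin (z * Complex.I) = 0 := by rw [Complex.sin_mul_I, h1, zero_mul]
    obtain ⟨k, hk⟩ := Complex.sin_eq_zero_iff.1 h2
    have h3 : z = ((-k : ℤ) : ℂ) * Real.pi * Complex.I := by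
      push_cast
      linear_combination (-Complex.I) * hk + z * Complex.I_mul_I
    refine ⟨-k, fun hk0 => h0 ?_, h3⟩
    rw [h3, hk0]
    simp

theorem Complex.cosh_ne_zero_of_sinhc_eq_zero {z : ℂ} (hz : Complex.sinhc z = 0) :
    Complex.cosh z ≠ 0 := by
  intro hc
  have h1 : Complex.sinh z = 0 := by
    unfold Complex.sinhc at hz
    split_ifs at hz with h0
    · simp at hz
    · simpa [h0] using hz
  have := Complex.cosh_sq_sub_sinh_sq z
  simp [hc, h1] at this

/-! ### Square values of integral quadratics -/

/-- An integral quadratic polynomial with square outer coefficients which takes square values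
at arbitrarily large arguments has discriminant zero. -/
theorem sq_eq_of_forall_exists_isSquare {l k c : ℤ} (hl : l ≠ 0) {t : ℕ → ℤ} (ht : StrictMono t)
    (h : ∀ n, ∃ m : ℤ, m * m = t n * t n * (l * l) + t n * c + k * k) :
    c * c = 4 * (l * l) * (k * k) := by
  by_contra hne
  have htn : ∀ n : ℕ, (n : ℤ) + t 0 ≤ t n := by
    intro n
    induction n with
    | zero => simp
    | succ n ih =>
      have := ht (Nat.lt_succ_self n)
      push_cast
      linarith [Int.add_one_le_iff.2 this]
  set N : ℤ := 4 * (l * l) * (k * k) - c * c with hN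
  have hN0 : N ≠ 0 := fun h0 => hne (by linarith)
  set n : ℕ := (|N| + |c| + |t 0| + 1).toNat with hn
  have hn' : (n : ℤ) = |N| + |c| + |t 0| + 1 := Int.toNat_of_nonneg (by positivity)
  have htl : |N| + |c| + 1 ≤ t n := by
    have := htn n
    have := neg_abs_le (t 0)
    linarith
  obtain ⟨m, hm⟩ := h n
  set x : ℤ := |2 * l * m| with hx
  set y : ℤ := 2 * (l * l) * t n + c with hy
  have hll : 1 ≤ l * l := by
    have := mul_self_pos.2 hl
    linarith
  have hy' : |N| < y := by
    have := neg_abs_le c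
    have := abs_nonneg N
    have := abs_nonneg c
    nlinarith
  -- Completing the square after multiplying by 4l². Since N ≠ 0, its divisor x + y is at most |N|,
  -- whereas y > |N|.
  have hxy : (x - y) * (x + y) = N := by
    have : x * x = (2 * l * m) * (2 * l * m) := abs_mul_abs_self _
    rw [hN, hy]
    linear_combination this + 4 * l * l * hm
  have hx0 : 0 ≤ x := abs_nonneg _
  have hdvd : (x + y) ∣ N := ⟨x - y, by rw [← hxy]; ring⟩
  have := Int.le_of_dvd (abs_pos.2 hN0) ((dvd_abs _ _).2 hdvd)
  linarith

/-! ### Traceless parts and common eigenvectors -/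

/-- A traceless 2 × 2 matrix squares to a scalar by Cayley–Hamilton; polarizing handles FG + GF. -/
theorem Module.End.exists_smul_one_add_sq_eq {E : Type*} [AddCommGroup E] [Module ℂ E]
    [FiniteDimensional ℂ E] (hE : Module.finrank ℂ E = 2) (f g : Module.End ℂ E) :
    ∃ (s r : ℂ) (F G : Module.End ℂ E) (a b c : ℂ), f = s • 1 + F ∧ g = r • 1 + G ∧
      F * F = a • 1 ∧ G * G = b • 1 ∧ F * G + G * F = c • 1 := by
  have key : ∀ M N : Matrix (Fin 2) (Fin 2) ℂ, ∃ (s r : ℂ) (F G : Matrix (Fin 2) (Fin 2) ℂ)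
      (a b c : ℂ), M = s • 1 + F ∧ N = r • 1 + G ∧
      F * F = a • 1 ∧ G * G = b • 1 ∧ F * G + G * F = c • 1 := by
    intro M N
    let x := (M 0 0 - M 1 1) / 2
    let u := (N 0 0 - N 1 1) / 2
    refine ⟨(M 0 0 + M 1 1) / 2, (N 0 0 + N 1 1) / 2, !![x, M 0 1; M 1 0, -x],
      !![u, N 0 1; N 1 0, -u], x * x + M 0 1 * M 1 0, u * u + N 0 1 * N 1 0,
      2 * x * u + M 0 1 * N 1 0 + M 1 0 * N 0 1, ?_, ?_, ?_, ?_, ?_⟩ <;>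
    ext i j <;> fin_cases i <;> fin_cases j <;> simp [x, u, Matrix.mul_apply] <;> ring
  let B := Module.finBasisOfFinrankEq ℂ E hE
  let Φ := LinearMap.toMatrixAlgEquiv B
  obtain ⟨s, r, F, G, a, b, c, h1, h2, h3, h4, h5⟩ := key (Φ f) (Φ g)
  refine ⟨s, r, Φ.symm F, Φ.symm G, a, b, c, ?_, ?_, ?_, ?_, ?_⟩ <;> apply Φ.injective <;>
    simpa

/-- Two endomorphisms have a common eigenvector. -/
def Module.End.HasCommonEigenvector {K E : Type*} [Field K] [AddCommGroup E] [Module K E]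
    (f g : Module.End K E) : Prop :=
  ∃ v : E, v ≠ 0 ∧ (∃ p : K, f v = p • v) ∧ ∃ q : K, g v = q • v

theorem Module.End.HasCommonEigenvector.simultaneouslyTrigonalizable {K E : Type*} [Field K]
    [AddCommGroup E] [Module K E] [FiniteDimensional K E] (hE : Module.finrank K E = 2)
    {f g : Module.End K E} (h : f.HasCommonEigenvector g) : SimultaneouslyTrigonalizable f g := by
  obtain ⟨v, hv, ⟨p, hp⟩, q, hq⟩ := h
  obtain ⟨w, hw⟩ : ∃ w : E, LinearIndependent K ![v, w] :=
    exists_linearIndependent_pair_of_one_lt_finrank (by omega) hv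
  let b₀ : Module.Basis (Fin 2) K E :=
    basisOfLinearIndependentOfCardEqFinrank hw (by simp [hE])
  have hb₀ : b₀ 0 = v := by simp [b₀]
  have main : ∀ (u : Module.End K E) (p : K), u v = p • v →
      (LinearMap.toMatrix (b₀.reindex (finCongr hE.symm)) (b₀.reindex (finCongr hE.symm))
        u).BlockTriangular id := by
    intro u p hu i j hij
    have hij' : (j : ℕ) < i := hij
    have hi := i.2
    have hj0 : (finCongr hE.symm).symm j = 0 := by
      ext
      simp
      omega
    have hi1 : (finCongr hE.symm).symm i = 1 := by
      ext
      simp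
      omega
    rw [LinearMap.toMatrix_apply, Module.Basis.reindex_apply, Module.Basis.repr_reindex_apply,
      hj0, hi1, hb₀, hu, ← hb₀]
    simp
  exact ⟨_, main f p hp, main g q hq⟩

theorem Module.End.HasCommonEigenvector.smul_one_add {K E : Type*} [Field K]
    [AddCommGroup E] [Module K E] {F G : Module.End K E} (h : F.HasCommonEigenvector G)
    (s r : K) : (s • 1 + F).HasCommonEigenvector (r • 1 + G) := by
  obtain ⟨v, hv, ⟨p, hp⟩, q, hq⟩ := h
  exact ⟨v, hv, ⟨s + p, by simp [hp, add_smul]⟩, r + q, by simp [hq, add_smul]⟩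

/-- In the absence of a common eigenvector, two traceless endomorphisms of a plane generate the
whole algebra of endomorphisms. -/
theorem Module.End.coeff_eq_zero_of_not_hasCommonEigenvector {E : Type*} [AddCommGroup E]
    [Module ℂ E] [FiniteDimensional ℂ E] (hE : Module.finrank ℂ E = 2) {F G : Module.End ℂ E}
    {a b c : ℂ} (hF : F * F = a • 1) (hG : G * G = b • 1) (hFG : F * G + G * F = c • 1)
    (h : ¬ F.HasCommonEigenvector G) :
    c * c ≠ 4 * a * b ∧ ∀ x y z w : ℂ, x • (1 : Module.End ℂ E) + y • F + z • G + w • (F * G) = 0 →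
      x = 0 ∧ y = 0 ∧ z = 0 ∧ w = 0 := by
  have : Nontrivial E := Module.nontrivial_of_finrank_pos (R := ℂ) (by omega)
  obtain ⟨α, hα⟩ := F.exists_eigenvalue
  obtain ⟨e, he⟩ := hα.exists_hasEigenvector
  have he0 : e ≠ 0 := he.2
  have hFe : F e = α • e := he.apply_eq_smul
  have hli : LinearIndependent ℂ ![e, G e] := by
    rw [LinearIndependent.pair_iff' he0]
    exact fun q hq => h ⟨e, he0, ⟨α, hFe⟩, q, hq.symm⟩
  have hpair := LinearIndependent.pair_iff.1 hli
  have hGG : G (G e) = b • e := by simpa using LinearMap.congr_fun hG e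
  have hFGe : F (G e) = c • e - α • G e := by
    have := LinearMap.congr_fun hFG e
    simp only [LinearMap.add_apply, Module.End.mul_apply, hFe, map_smul, LinearMap.smul_apply,
      Module.End.one_apply] at this
    exact eq_sub_of_add_eq this
  have ha : a = α * α := by
    have := LinearMap.congr_fun hF e
    simp only [Module.End.mul_apply, hFe, map_smul, LinearMap.smul_apply,
      Module.End.one_apply, smul_smul] at this
    exact (smul_left_injective ℂ he0 this).symm
  have hD : c * c ≠ 4 * a * b := by
    intro hD
    rw [ha] at hD
    by_cases hα0 : α = 0
    · have hc : c = 0 := by simpa [hα0] using hD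
      have hF0 : F = 0 := by
        refine (basisOfLinearIndependentOfCardEqFinrank hli (by simp [hE])).ext fun i => ?_
        fin_cases i <;> simp [hFe, hFGe, hα0, hc]
      obtain ⟨q, hq⟩ := G.exists_eigenvalue
      obtain ⟨v, hv⟩ := hq.exists_hasEigenvector
      exact h ⟨v, hv.2, ⟨0, by simp [hF0]⟩, q, hv.apply_eq_smul⟩
    -- The vector is (F - α)(G e), which F + α kills because F² = α²; c² = 4ab makes it an
    -- eigenvector of G too.
    · refine h ⟨c • e - (2 * α) • G e, fun h0 => ?_, ⟨-α, ?_⟩, -c / (2 * α), ?_⟩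
      · have := (hpair c (-(2 * α)) (by rw [← h0]; module)).2
        simp [hα0] at this
      · simp only [map_sub, map_smul, hFe, hFGe]
        module
      · simp only [map_sub, map_smul, hGG]
        match_scalars
        · field_simp
        · field_simp
          linear_combination hD
  refine ⟨hD, fun x y z w hrel => ?_⟩
  have h1 := LinearMap.congr_fun hrel e
  have h2 := LinearMap.congr_fun hrel (G e)
  simp only [LinearMap.add_apply, LinearMap.smul_apply, Module.End.one_apply, Module.End.mul_apply,
    LinearMap.zero_apply, hFe, hFGe, hGG, map_smul] at h1 h2
  obtain ⟨h11, h12⟩ := hpair (x + y * α + w * c) (z - w * α) (by rw [← h1]; module)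
  obtain ⟨h21, h22⟩ := hpair (y * c + z * b + w * b * α) (x - y * α) (by rw [← h2]; module)
  have hD' : c * c - 4 * (α * α) * b ≠ 0 := by
    rw [← ha]
    exact sub_ne_zero.2 hD
  have hw : w = 0 := by
    refine (mul_eq_zero.1 (?_ : w * (c * c - 4 * (α * α) * b) = 0)).resolve_right hD'
    linear_combination c * h11 - 2 * α * h21 + 2 * α * b * h12 - c * h22
  subst hw
  have hz : z = 0 := by linear_combination h12
  subst hz
  have hy : y = 0 := by
    refine (mul_eq_zero.1 (?_ : y * (c * c - 4 * (α * α) * b) = 0)).resolve_right hD'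
    linear_combination c * h21 - 2 * α * b * h11 + 2 * α * b * h22
  subst hy
  exact ⟨by linear_combination h22, rfl, rfl, rfl⟩

/-! ### Comparing coefficients -/

theorem endExp_smul_add_relation {E : Type*} [AddCommGroup E] [Module ℂ E]
    [FiniteDimensional ℂ E] {F G : Module.End ℂ E} {α β c : ℂ} (s r : ℂ)
    (hF : F * F = (α * α) • 1) (hG : G * G = (β * β) • 1) (hFG : F * G + G * F = c • 1) {t γ : ℂ}
    (hγ : γ * γ = t * t * (α * α) + t * c + β * β)
    (h : endExp (t • (s • 1 + F) + (r • 1 + G)) =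
      endExp (t • (s • 1 + F)) ∘ₗ endExp (r • 1 + G)) :
    (Complex.cosh γ - Complex.cosh (t * α) * Complex.cosh β) • (1 : Module.End ℂ E) +
      (t * (Complex.sinhc γ - Complex.sinhc (t * α) * Complex.cosh β)) • F +
      (Complex.sinhc γ - Complex.cosh (t * α) * Complex.sinhc β) • G +
      (-(t * Complex.sinhc (t * α) * Complex.sinhc β)) • (F * G) = 0 := by
  have e1 : t • (s • (1 : Module.End ℂ E) + F) + (r • 1 + G) = (t * s + r) • 1 + (t • F + G) := by
    module
  have e2 : t • (s • (1 : Module.End ℂ E) + F) = (t * s) • 1 + t • F := by module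
  have q1 : (t • F + G) * (t • F + G) = (γ * γ) • (1 : Module.End ℂ E) := by
    have : (t • F + G) * (t • F + G) = (t * t) • (F * F) + t • (F * G + G * F) + G * G := by
      simp only [mul_add, add_mul, smul_mul_assoc, mul_smul_comm]
      module
    rw [this, hF, hG, hFG, hγ]
    module
  have q2 : (t • F) * (t • F) = ((t * α) * (t * α)) • (1 : Module.End ℂ E) := by
    rw [smul_mul_assoc, mul_smul_comm, hF]
    module
  rw [e1, e2, endExp_smul_one_add_of_sq_eq q1, endExp_smul_one_add_of_sq_eq q2,
    endExp_smul_one_add_of_sq_eq hG, ← Module.End.mul_eq_comp, smul_mul_smul_comm,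
    ← Complex.exp_add] at h
  have h' := smul_right_injective (Module.End ℂ E) (Complex.exp_ne_zero _) h
  simp only [mul_add, add_mul, smul_mul_assoc, mul_smul_comm, one_mul, mul_one] at h'
  rw [← sub_eq_zero] at h'
  rw [← h']
  module

theorem corollary1 {E : Type*} [AddCommGroup E] [Module ℂ E] [FiniteDimensional ℂ E]
    (hE : Module.finrank ℂ E = 2) (f g : Module.End ℂ E)
    (t : ℕ → ℤ) (ht : StrictMono t) (ht0 : t 0 = 1) (ht1 : t 1 = 2)
    (h : ∀ n : ℕ, endExp ((t n : ℂ) • f + g) = endExp ((t n : ℂ) • f) ∘ₗ endExp g) :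
    SimultaneouslyTrigonalizable f g := by
  obtain ⟨s, r, F, G, a, b, c, rfl, rfl, hF, hG, hFG⟩ :=
    Module.End.exists_smul_one_add_sq_eq hE f g
  by_contra hcon
  have hne : ¬ F.HasCommonEigenvector G := fun hc =>
    hcon ((hc.smul_one_add s r).simultaneouslyTrigonalizable hE)
  obtain ⟨hD, hind⟩ := Module.End.coeff_eq_zero_of_not_hasCommonEigenvector hE hF hG hFG hne
  obtain ⟨α, rfl⟩ := IsAlgClosed.exists_eq_mul_self a
  obtain ⟨β, rfl⟩ := IsAlgClosed.exists_eq_mul_self b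
  have hγ : ∀ n, ∃ γ : ℂ, (t n : ℂ) * t n * (α * α) + t n * c + β * β = γ * γ := fun n =>
    IsAlgClosed.exists_eq_mul_self _
  choose γ hγ using hγ
  have hrel := fun n => hind _ _ _ _
    (endExp_smul_add_relation s r hF hG hFG (hγ n).symm (h n))
  -- The FG coefficient kills one factor; the F and G coefficients both compute `sinhc (γ 0)`, which
  -- transfers the vanishing to the other.
  have hαβ : Complex.sinhc α = 0 ∧ Complex.sinhc β = 0 := by
    obtain ⟨-, h1, h2, h3⟩ := hrel 0
    simp only [ht0, Int.cast_one, one_mul, neg_eq_zero, mul_eq_zero, sub_eq_zero] at h1 h2 h3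
    rcases h3 with h3 | h3
    · refine ⟨h3, ?_⟩
      have := h2.symm.trans h1
      rw [h3, zero_mul] at this
      exact (mul_eq_zero.1 this).resolve_left (Complex.cosh_ne_zero_of_sinhc_eq_zero h3)
    · refine ⟨?_, h3⟩
      have := h1.symm.trans h2
      rw [h3, mul_zero] at this
      exact (mul_eq_zero.1 this).resolve_right (Complex.cosh_ne_zero_of_sinhc_eq_zero h3)
  have hγ0 : ∀ n, Complex.sinhc (γ n) = 0 := by
    intro n
    obtain ⟨-, -, h2, -⟩ := hrel n
    simpa [hαβ.2] using h2
  obtain ⟨l, hl, rfl⟩ := Complex.exists_int_of_sinhc_eq_zero hαβ.1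
  obtain ⟨k, -, rfl⟩ := Complex.exists_int_of_sinhc_eq_zero hαβ.2
  choose m _ hm using fun n => Complex.exists_int_of_sinhc_eq_zero (hγ0 n)
  have hπ : (Real.pi : ℂ) ≠ 0 := by exact_mod_cast Real.pi_ne_zero
  have hI := Complex.I_mul_I
  -- Since t₀ = 1, the equation for γ₀ expresses c through squares of integer multiples of πi.
  obtain ⟨d, hd⟩ : ∃ d : ℤ, c = -(Real.pi * Real.pi) * d := by
    refine ⟨m 0 * m 0 - l * l - k * k, ?_⟩
    have := hγ 0
    rw [hm 0, ht0] at this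
    push_cast at this ⊢
    linear_combination this + (Real.pi : ℂ) * Real.pi * (m 0 * m 0 - l * l - k * k) * hI
  have hsq : d * d = 4 * (l * l) * (k * k) := by
    refine sq_eq_of_forall_exists_isSquare hl ht fun n => ⟨m n, ?_⟩
    have := hγ n
    rw [hm n, hd] at this
    have h2 : (Real.pi : ℂ) * Real.pi *
        ((m n : ℂ) * m n - (t n * t n * (l * l) + t n * d + k * k)) = 0 := by
      linear_combination this + (Real.pi : ℂ) * Real.pi *
        ((m n : ℂ) * m n - (t n * t n * (l * l) + k * k)) * hI
    have h3 := (mul_eq_zero.1 h2).resolve_left (mul_ne_zero hπ hπ)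
    exact_mod_cast sub_eq_zero.1 h3
  apply hD
  have hsq' : (d : ℂ) * d = 4 * (l * l) * (k * k) := by exact_mod_cast hsq
  rw [hd]
  linear_combination (Real.pi : ℂ) ^ 4 * hsq' -
    4 * (Real.pi : ℂ) ^ 4 * l ^ 2 * k ^ 2 * (Complex.I ^ 2 - 1) * hI
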